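/- Let $\Sigma$ be a finite alphabet with at least two letters. Let $\mathrm{PAL}=\{xx^R : x\in\Sigma^+\}$ be the language of nonempty even-length palindromes over $\Sigma$ (where $x^R$ is the reversal of $x$), and let $\mathrm{PALSTAR}=\mathrm{PAL}^*$ be the language of palstars. Let $\mathrm{PRIMEPALSTAR}$ be the language of prime palstars, i.e. of the nonempty palstars that cannot be written as the product $uv$ of two nonempty palstars $u,v$. Call a language $L\subseteq\Sigma^*$ closed if $L=L^*$, and for closed $L$ define the inverse star $L^{-*}=\bigcap_{S\subseteq\Sigma^*,\ S^*=L} S$. Then $\mathrm{PRIMEPALSTAR}$ is not context-free. Moreover, $\mathrm{PALSTAR}$ is closed and context-free, and $\mathrm{PRIMEPALSTAR}=\mathrm{PALSTAR}^{-*}$. Consequently the class of context-free languages over $\Sigma$ is not closed under inverse star: not every closed context-free language $L\subseteq\Sigma^*$ has a context-free inverse star $L^{-*}$. -/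

import Mathlib

open scoped Computability

namespace Palstars

/-- The nonempty palindromes of even length: all words `x xᴿ` with `x` a nonempty word. -/
def PAL (α : Type*) : Language α :=
  {w : List α | ∃ x : List α, x ≠ [] ∧ w = x ++ x.reverse}

/-- The palstars: the Kleene closure of `PAL`. -/
def PALSTAR (α : Type*) : Language α :=
  (PAL α)∗

/-- The prime palstars: nonempty palstars that are not the product of two nonempty palstars.
(The empty word is a palstar, so it must be excluded as a factor: `w = w ε` always holds.
It is not itself prime, being the empty product of palindromes.) -/
def PRIMEPALSTAR (α : Type*) : Language α :=
  {w : List α | w ∈ PALSTAR α ∧ w ≠ [] ∧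
    ¬ ∃ u v : List α, u ∈ PALSTAR α ∧ u ≠ [] ∧ v ∈ PALSTAR α ∧ v ≠ [] ∧ w = u ++ v}

/-- A language is closed if it equals its Kleene closure. -/
def IsStarClosed {α : Type*} (L : Language α) : Prop :=
  L = L∗

/-- The inverse star `L^{-*}` of a closed language `L`: the intersection of all languages `S`
with `S∗ = L`. It is only meaningful for closed `L`. -/
def inverseStar {α : Type*} (L : Language α) : Language α :=
  {w : List α | ∀ S : Language α, S∗ = L → w ∈ S}

end Palstars

/-! Call two equal adjacent letters a stutter. A nonempty even palindrome has a stutter at its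
centre, and a stutter-free word over two letters alternates. So a prime palstar over two letters
with exactly three stutters reads `s f f t tᴿ f f sᴿ`. If `|t| ≥ |s|`, then `sᴿ` is a prefix of `t`
and the palindrome `s f f sᴿ` splits off at both ends. Hence `s` bounds the length
(`length_le_of_mem_PRIMEPALSTAR`). A word with `|t| = |s| - 1` attains the bound and is prime
(`halfWord_append_reverse_mem_PRIMEPALSTAR`).

Pumping such a word up gives a contradiction. In `exists_pumping` the pumped factor keeps its colour
in a finite set, so the word still has three stutters; palindromic symmetry preserves `s`; yet the
word is longer.

The prime palstars generate all palstars and lie in every generating set, so they form the inverse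
star. -/

namespace ContextFreeGrammar

/-! ### Parse trees of least height and the pumping lemma -/

variable {T : Type*}

/-- `Yields P s w` says that the word `w` is obtained from the string `s` by replacing every
nonterminal `A` of `s` by some word `u` with `P A u`. -/
inductive Yields {N : Type*} (P : N → List T → Prop) : List (Symbol T N) → List T → Prop
  | nil : Yields P [] []
  | terminal (t : T) {s : List (Symbol T N)} {w : List T} :
      Yields P s w → Yields P (Symbol.terminal t :: s) (t :: w)
  | nonterminal {A : N} {u : List T} {s : List (Symbol T N)} {w : List T} :
      P A u → Yields P s w → Yields P (Symbol.nonterminal A :: s) (u ++ w)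

namespace Yields

variable {N : Type*} {P Q : N → List T → Prop} {s s' : List (Symbol T N)} {w w' : List T}

lemma mono (h : ∀ A u, P A u → Q A u) (hs : Yields P s w) : Yields Q s w := by
  induction hs with
  | nil => exact .nil
  | terminal t _ ih => exact .terminal t ih
  | nonterminal hA _ ih => exact .nonterminal (h _ _ hA) ih

lemma append (hs : Yields P s w) (hs' : Yields P s' w') : Yields P (s ++ s') (w ++ w') := by
  induction hs with
  | nil => exact hs'
  | terminal t _ ih => exact .terminal t ih
  | nonterminal hA _ ih => rw [List.append_assoc]; exact .nonterminal hA ih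

lemma exists_of_append (h : Yields P (s ++ s') w) :
    ∃ u v, w = u ++ v ∧ Yields P s u ∧ Yields P s' v := by
  induction s generalizing w with
  | nil => exact ⟨[], w, rfl, .nil, h⟩
  | cons x s ih =>
    cases h with
    | terminal t h =>
      obtain ⟨u, v, rfl, hu, hv⟩ := ih h
      exact ⟨t :: u, v, rfl, .terminal t hu, hv⟩
    | nonterminal hA h =>
      obtain ⟨u, v, rfl, hu, hv⟩ := ih h
      exact ⟨_ ++ u, v, by simp, .nonterminal hA hu, hv⟩

lemma map_terminal (P : N → List T → Prop) (w : List T) : Yields P (w.map .terminal) w := by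
  induction w with
  | nil => exact .nil
  | cons t w ih => exact .terminal t ih

lemma length_le {B : ℕ} (hB : 1 ≤ B) (hP : ∀ A u, P A u → u.length ≤ B) (hs : Yields P s w) :
    w.length ≤ s.length * B := by
  induction hs with
  | nil => simp
  | terminal t _ ih => simp only [List.length_cons, Nat.succ_mul]; omega
  | nonterminal hA _ ih =>
    have := hP _ _ hA
    simp only [List.length_cons, List.length_append, Nat.succ_mul]
    omega

/-- If `Q` is not sufficient to obtain `w` from `s` then some nonterminal of `s` is responsible. -/
lemma exists_not (hs : Yields P s w) (hQ : ¬ Yields Q s w) :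
    ∃ s₁ A s₂ w₁ u w₂, s = s₁ ++ Symbol.nonterminal A :: s₂ ∧ w = w₁ ++ u ++ w₂ ∧
      Yields P s₁ w₁ ∧ P A u ∧ ¬ Q A u ∧ Yields P s₂ w₂ := by
  induction hs with
  | nil => exact absurd .nil hQ
  | terminal t _ ih =>
    obtain ⟨s₁, A, s₂, w₁, u, w₂, rfl, rfl, h₁, hP, hn, h₂⟩ := ih fun h => hQ (.terminal t h)
    exact ⟨.terminal t :: s₁, A, s₂, t :: w₁, u, w₂, rfl, rfl, .terminal t h₁, hP, hn, h₂⟩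
  | @nonterminal B v s w hA hs ih =>
    by_cases hB : Q B v
    · obtain ⟨s₁, A, s₂, w₁, u, w₂, rfl, rfl, h₁, hP, hn, h₂⟩ := ih fun h => hQ (.nonterminal hB h)
      exact ⟨.nonterminal B :: s₁, A, s₂, v ++ w₁, u, w₂, rfl, by simp, .nonterminal hA h₁, hP, hn,
        h₂⟩
    · exact ⟨[], B, s, [], v, w, rfl, rfl, .nil, hA, hB, hs⟩

end Yields

/-- `g.GenHeight h A w`: the nonterminal `A` has a parse tree of height at most `h` with yield
`w`. -/
def GenHeight (g : ContextFreeGrammar T) : ℕ → g.NT → List T → Prop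
  | 0 => fun _ _ => False
  | h + 1 => fun A w => ∃ r ∈ g.rules, r.input = A ∧ Yields (GenHeight g h) r.output w

variable {g : ContextFreeGrammar T}

lemma GenHeight.succ {h : ℕ} {A : g.NT} {w : List T} (hw : g.GenHeight h A w) :
    g.GenHeight (h + 1) A w := by
  induction h generalizing A w with
  | zero => exact hw.elim
  | succ h ih =>
    obtain ⟨r, hr, hA, hy⟩ := hw
    exact ⟨r, hr, hA, hy.mono fun _ _ => ih⟩

lemma GenHeight.mono {h h' : ℕ} (hh : h ≤ h') {A : g.NT} {w : List T} (hw : g.GenHeight h A w) :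
    g.GenHeight h' A w := by
  induction hh with
  | refl => exact hw
  | step _ ih => exact ih.succ

lemma Yields.derives {P : g.NT → List T → Prop}
    (hP : ∀ A u, P A u → g.Derives [.nonterminal A] (u.map .terminal))
    {s : List (Symbol T g.NT)} {w : List T} (hs : Yields P s w) :
    g.Derives s (w.map .terminal) := by
  induction hs with
  | nil => exact .refl _
  | terminal t _ ih => exact ih.append_left [.terminal t]
  | @nonterminal A u s w hA hs ih =>
    rw [List.map_append]
    exact ((hP _ _ hA).append_right s).trans (ih.append_left _)

lemma derives_of_mem_rules {r : ContextFreeRule T g.NT} (hr : r ∈ g.rules) :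
    g.Derives [.nonterminal r.input] r.output :=
  Produces.single ⟨r, hr, .input_output⟩

lemma GenHeight.derives {h : ℕ} {A : g.NT} {w : List T} (hw : g.GenHeight h A w) :
    g.Derives [.nonterminal A] (w.map .terminal) := by
  induction h generalizing A w with
  | zero => exact hw.elim
  | succ h ih =>
    obtain ⟨r, hr, rfl, hy⟩ := hw
    exact (derives_of_mem_rules hr).trans (hy.derives fun _ _ => ih)

/-- Undoing the first step of the derivation gathers the trees over the rule's output under one new
root; all other trees are allowed the same extra unit of height. -/
lemma Derives.exists_yields {s : List (Symbol T g.NT)} {w : List T}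
    (hs : g.Derives s (w.map .terminal)) : ∃ h, Yields (g.GenHeight h) s w := by
  induction hs using Relation.ReflTransGen.head_induction_on with
  | refl => exact ⟨0, .map_terminal _ w⟩
  | head hstep _ ih =>
    obtain ⟨h, hy⟩ := ih
    obtain ⟨r, hr, hrw⟩ := hstep
    obtain ⟨p, q, rfl, rfl⟩ := hrw.exists_parts
    obtain ⟨u', w₃, rfl, hy', h₃⟩ := hy.exists_of_append
    obtain ⟨w₁, w₂, rfl, h₁, h₂⟩ := hy'.exists_of_append
    refine ⟨h + 1, .append (.append (h₁.mono fun _ _ => .succ) ?_) (h₃.mono fun _ _ => .succ)⟩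
    have : g.GenHeight (h + 1) r.input w₂ := ⟨r, hr, rfl, h₂⟩
    simpa using Yields.nonterminal this .nil

lemma Derives.exists_genHeight {A : g.NT} {w : List T}
    (hs : g.Derives [.nonterminal A] (w.map .terminal)) : ∃ h, g.GenHeight h A w := by
  obtain ⟨h, hy⟩ := hs.exists_yields
  cases hy with
  | nonterminal hA hn => cases hn; exact ⟨h, by simpa using hA⟩

lemma GenHeight.length_le {b : ℕ} (hb : 1 ≤ b) (hg : ∀ r ∈ g.rules, r.output.length ≤ b)
    {h : ℕ} {A : g.NT} {w : List T} (hw : g.GenHeight h A w) : w.length ≤ b ^ h := by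
  induction h generalizing A w with
  | zero => exact hw.elim
  | succ h ih =>
    obtain ⟨r, hr, -, hy⟩ := hw
    calc w.length ≤ r.output.length * b ^ h := hy.length_le (Nat.one_le_pow _ _ hb) fun _ _ => ih
      _ ≤ b * b ^ h := Nat.mul_le_mul_right _ (hg r hr)
      _ = b ^ (h + 1) := (pow_succ' b h).symm

/-- The least height of a parse tree for `w` with root `A` is `h + 1`. -/
def ExactHeight (g : ContextFreeGrammar T) (h : ℕ) (n : g.NT × List T) : Prop :=
  g.GenHeight (h + 1) n.1 n.2 ∧ ¬ g.GenHeight h n.1 n.2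

lemma ExactHeight.unique {h h' : ℕ} {n : g.NT × List T} (hn : g.ExactHeight h n)
    (hn' : g.ExactHeight h' n) : h = h' := by
  by_contra hne
  rcases Nat.lt_or_gt_of_ne hne with hlt | hlt
  · exact hn'.2 (hn.1.mono hlt)
  · exact hn.2 (hn'.1.mono hlt)

/-- `(A, w)` has `(B, w')` as a descendant: `A` derives `v B x` with `w = v w' x`. -/
def HasDescendant (g : ContextFreeGrammar T) (n m : g.NT × List T) : Prop :=
  ∃ v x, n.2 = v ++ m.2 ++ x ∧
    g.Derives [.nonterminal n.1] (v.map .terminal ++ [.nonterminal m.1] ++ x.map .terminal)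

lemma HasDescendant.refl (n : g.NT × List T) : g.HasDescendant n n :=
  ⟨[], [], by simp, .refl _⟩

lemma HasDescendant.trans {n m k : g.NT × List T} (h₁ : g.HasDescendant n m)
    (h₂ : g.HasDescendant m k) : g.HasDescendant n k := by
  obtain ⟨v, x, e, d⟩ := h₁
  obtain ⟨v', x', e', d'⟩ := h₂
  refine ⟨v ++ v', x' ++ x, by simp [e, e'], d.trans ?_⟩
  simpa using (d'.append_left (v.map .terminal)).append_right (x.map .terminal)

/-- If every child had a lower tree, so would the root; hence some child has least height exactly
one below. -/
lemma ExactHeight.exists_descendant {h : ℕ} {n : g.NT × List T} (hn : g.ExactHeight (h + 1) n) :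
    ∃ m, g.ExactHeight h m ∧ g.HasDescendant n m := by
  obtain ⟨⟨r, hr, hA, hy⟩, hn⟩ := hn
  obtain ⟨s₁, B, s₂, w₁, u, w₂, hs, hw, h₁, hP, hQ, h₂⟩ :=
    hy.exists_not (Q := g.GenHeight h) fun hQ => hn ⟨r, hr, hA, hQ⟩
  refine ⟨(B, u), ⟨hP, hQ⟩, w₁, w₂, hw, ?_⟩
  have d := derives_of_mem_rules hr
  rw [hs, hA] at d
  refine d.trans ?_
  have d₁ := (h₁.derives fun _ _ => GenHeight.derives).append_right (.nonterminal B :: s₂)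
  have d₂ := (h₂.derives fun _ _ => GenHeight.derives).append_left
    (w₁.map .terminal ++ [.nonterminal B])
  refine d₁.trans ?_
  simpa using d₂

lemma ExactHeight.exists_path {h : ℕ} {n : g.NT × List T} (hn : g.ExactHeight h n) :
    ∃ f : ℕ → g.NT × List T, f h = n ∧ (∀ i ≤ h, g.ExactHeight i (f i)) ∧
      ∀ i j, i ≤ j → j ≤ h → g.HasDescendant (f j) (f i) := by
  induction h generalizing n with
  | zero =>
    refine ⟨fun _ => n, rfl, fun i hi => ?_, fun _ _ _ _ => .refl n⟩
    obtain rfl : i = 0 := by omega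
    exact hn
  | succ h ih =>
    obtain ⟨m, hm, hd⟩ := hn.exists_descendant
    obtain ⟨f, hf, he, hp⟩ := ih hm
    refine ⟨Function.update f (h + 1) n, by simp, fun i hi => ?_, fun i j hij hj => ?_⟩
    · rcases Nat.lt_or_ge i (h + 1) with hlt | hge
      · rw [Function.update_of_ne hlt.ne]; exact he i (by omega)
      · obtain rfl : i = h + 1 := by omega
        simpa using hn
    · rcases Nat.lt_or_ge j (h + 1) with hlt | hge
      · rw [Function.update_of_ne hlt.ne, Function.update_of_ne (by omega)]
        exact hp i j hij (by omega)
      · obtain rfl : j = h + 1 := by omega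
        rcases Nat.lt_or_ge i (h + 1) with hlt | hge
        · rw [Function.update_self, Function.update_of_ne hlt.ne]
          exact hd.trans (hf ▸ hp i h (by omega) le_rfl)
        · obtain rfl : i = h + 1 := by omega
          exact .refl _

end ContextFreeGrammar

/-- The pumping lemma, relative to a colouring of the words with finitely many colours: the word
`v w x` which is enlarged to `v v w x x` may be taken to have the same colour as `w`. For a colouring
by a homomorphism to a finite monoid, this makes the pumping stay inside a regular language. -/
theorem Language.IsContextFree.exists_pumping {T M : Type*} [Finite M] {L : Language T}
    (hL : L.IsContextFree) (c : List T → M) :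
    ∃ p : ℕ, ∀ z ∈ L, p < z.length → ∃ u v w x y : List T,
      z = u ++ (v ++ w ++ x) ++ y ∧ (v ++ w ++ x).length ≤ p ∧ 0 < v.length + x.length ∧
      c (v ++ w ++ x) = c w ∧ u ++ (v ++ (v ++ w ++ x) ++ x) ++ y ∈ L := by
  classical
  obtain ⟨g, rfl⟩ := hL
  have := Fintype.ofFinite M
  -- The added one keeps `b` positive when every rule has empty output.
  let b := g.rules.sup (fun r => r.output.length) + 1
  have hb : 1 ≤ b := by simp [b]
  have hg : ∀ r ∈ g.rules, r.output.length ≤ b := fun r hr =>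
    (Finset.le_sup (f := fun r : ContextFreeRule T g.NT => r.output.length) hr).trans
      (Nat.le_succ _)
  -- Only inputs of rules occur as inner nodes, so the labels are finite even if `g.NT` is not.
  let labels : Finset (g.NT × M) := g.rules.image (·.input) ×ˢ Finset.univ
  let K := labels.card
  refine ⟨b ^ (K + 1), fun z hz hlen => ?_⟩
  obtain ⟨h', hh'⟩ := ContextFreeGrammar.Derives.exists_genHeight hz
  have hex : ∃ h, g.GenHeight h g.initial z := ⟨h', hh'⟩
  obtain ⟨h, hh⟩ : ∃ h, Nat.find hex = h + 1 := by
    refine Nat.exists_eq_succ_of_ne_zero fun h0 => ?_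
    have := Nat.find_spec hex
    rw [h0] at this
    exact this
  have hroot : g.ExactHeight h (g.initial, z) :=
    ⟨hh ▸ Nat.find_spec hex, Nat.find_min hex (by omega)⟩
  have hK : K < h + 1 := by
    by_contra hlt
    exact absurd ((hroot.1.mono (by omega : h + 1 ≤ K + 1)).length_le hb hg) (by simpa using hlen)
  obtain ⟨f, hf, he, hp⟩ := hroot.exists_path
  -- The repetition is sought among the lowest `K + 1` nodes of the path, so that the pumped factor
  -- has length at most `b ^ (K + 1)`.
  obtain ⟨i, hi, j, hj, hij, hlab⟩ : ∃ i ∈ Finset.range (K + 1), ∃ j ∈ Finset.range (K + 1),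
      i ≠ j ∧ ((f i).1, c (f i).2) = ((f j).1, c (f j).2) := by
    refine Finset.exists_ne_map_eq_of_card_lt_of_maps_to (t := labels) (by simp [K]) ?_
    intro i hi
    obtain ⟨r, hr, hA, -⟩ := (he i (by simp at hi; omega)).1
    simp only [labels, Finset.coe_product, Set.mem_prod]
    exact ⟨by simpa using ⟨r, hr, hA⟩, by simp⟩
  wlog hlt : i < j generalizing i j
  · exact this j hj i hi hij.symm hlab.symm (by omega)
  simp only [Finset.mem_range] at hi hj
  simp only [Prod.mk.injEq] at hlab
  obtain ⟨u, y, ez, du⟩ := hp j h (by omega) le_rfl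
  obtain ⟨v, x, ev, dv⟩ := hp i j hlt.le (by omega)
  rw [hf] at ez du
  refine ⟨u, v, (f i).2, x, y, ?_, ?_, ?_, ?_, ?_⟩
  · rw [← ev]; exact ez
  · rw [← ev]
    exact ((he j (by omega)).1.mono (by omega)).length_le hb hg
  -- With `v` and `x` empty the two nodes would coincide, but their least heights differ.
  · by_contra h0
    have hv : v = [] := List.length_eq_zero_iff.1 (by omega)
    have hx : x = [] := List.length_eq_zero_iff.1 (by omega)
    have hfij : f i = f j := Prod.ext hlab.1 (by simpa [hv, hx] using ev.symm)
    have := he j (by omega)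
    exact hij ((he i (by omega)).unique (hfij ▸ this))
  · rw [← ev, hlab.2]
  · rw [← ev, ContextFreeGrammar.mem_language_iff]
    have dj := (he j (by omega)).1.derives
    rw [hlab.1] at dv
    have d₁ := (dv.append_left (u.map .terminal)).append_right (y.map .terminal)
    have d₂ := (dj.append_left ((u ++ v).map .terminal)).append_right ((x ++ y).map .terminal)
    simp only [List.map_append, List.append_assoc] at du d₁ d₂ ⊢
    exact du.trans (d₁.trans d₂)

/-! ### Prime palstars and the inverse star -/

namespace Palstars
variable {α : Type*}

lemma ne_nil_of_mem_PAL {w : List α} (h : w ∈ PAL α) : w ≠ [] := by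
  obtain ⟨x, hx, rfl⟩ := h
  simp [hx]

lemma PAL_subset_PALSTAR {w : List α} (h : w ∈ PAL α) : w ∈ PALSTAR α :=
  Language.mem_kstar.2 ⟨[w], by simp, by simpa using h⟩

lemma append_mem_PALSTAR {u v : List α} (hu : u ∈ PALSTAR α) (hv : v ∈ PALSTAR α) :
    u ++ v ∈ PALSTAR α := by
  have : u ++ v ∈ (PAL α)∗ * (PAL α)∗ := Language.append_mem_mul hu hv
  rwa [kstar_mul_kstar] at this

lemma exists_PAL_prefix {w : List α} (hw : w ∈ PALSTAR α) (hne : w ≠ []) :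
    ∃ u v, u ∈ PAL α ∧ v ∈ PALSTAR α ∧ w = u ++ v := by
  obtain ⟨l, rfl, hl⟩ := Language.mem_kstar.1 hw
  cases l with
  | nil => simp at hne
  | cons u l =>
    exact ⟨u, l.flatten, hl u (by simp), Language.join_mem_kstar fun y hy => hl y (by simp [hy]),
      by simp⟩

lemma mem_PAL_of_mem_PRIMEPALSTAR {w : List α} (hw : w ∈ PRIMEPALSTAR α) : w ∈ PAL α := by
  obtain ⟨h, hne, hp⟩ := hw
  obtain ⟨u, v, hu, hv, rfl⟩ := exists_PAL_prefix h hne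
  rcases eq_or_ne v [] with rfl | hvne
  · simpa using hu
  · exact absurd ⟨u, v, PAL_subset_PALSTAR hu, ne_nil_of_mem_PAL hu, hv, hvne, rfl⟩ hp

lemma isStarClosed_PALSTAR (α : Type*) : IsStarClosed (PALSTAR α) :=
  (kstar_idem (PAL α)).symm

lemma kstar_PRIMEPALSTAR (α : Type*) : (PRIMEPALSTAR α)∗ = PALSTAR α := by
  refine le_antisymm ?_ ?_
  · have : PRIMEPALSTAR α ≤ PALSTAR α := fun w hw => hw.1
    exact (kstar_mono this).trans_eq (isStarClosed_PALSTAR α).symm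
  · intro w hw
    induction hn : w.length using Nat.strong_induction_on generalizing w with
    | _ n ih =>
      subst hn
      by_cases hne : w = []
      · subst hne; exact Language.nil_mem_kstar _
      by_cases hd : ∃ u v : List α, u ∈ PALSTAR α ∧ u ≠ [] ∧ v ∈ PALSTAR α ∧ v ≠ [] ∧ w = u ++ v
      · obtain ⟨u, v, hu, hu0, hv, hv0, rfl⟩ := hd
        have h₁ := List.length_pos_iff.2 hu0
        have h₂ := List.length_pos_iff.2 hv0
        have : u ++ v ∈ (PRIMEPALSTAR α)∗ * (PRIMEPALSTAR α)∗ :=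
          Language.append_mem_mul (ih _ (by simp; omega) hu rfl) (ih _ (by simp; omega) hv rfl)
        rwa [kstar_mul_kstar] at this
      · exact Language.mem_kstar.2 ⟨[w], by simp, by simpa using ⟨hw, hne, hd⟩⟩

/-- A prime palstar factors into nonempty words of `S`, all of them palstars; primality leaves a
single factor. Conversely, the primes are themselves an admissible `S`. -/
lemma PRIMEPALSTAR_eq_inverseStar (α : Type*) :
    PRIMEPALSTAR α = inverseStar (PALSTAR α) := by
  ext w
  refine ⟨fun ⟨hw, hne, hp⟩ S hS => ?_, fun h => h _ (kstar_PRIMEPALSTAR α)⟩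
  rw [← hS] at hw
  obtain ⟨l, rfl, hl⟩ := Language.mem_kstar_iff_exists_nonempty.1 hw
  have hstar : ∀ l' : List (List α), (∀ y ∈ l', y ∈ S ∧ y ≠ []) → l'.flatten ∈ PALSTAR α :=
    fun l' h => hS ▸ Language.join_mem_kstar fun y hy => (h y hy).1
  match l with
  | [] => simp at hne
  | [u] => simpa using (hl u (by simp)).1
  | u :: v :: l =>
    refine absurd ⟨u, (v :: l).flatten, ?_, (hl u (by simp)).2, hstar _ fun y hy => hl y ?_, ?_,
      by simp⟩ hp
    · simpa using hstar [u] fun y hy => hl y (by simp_all)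
    · exact List.mem_cons_of_mem _ hy
    · simp [(hl v (by simp)).2]

end Palstars

/-! ### A context-free grammar for the palstars -/

namespace Palstars

open Classical in
/-- The rules `S → ε | P S`, `P → a P a | a a`, where `S` is `false` and `P` is `true`. -/
noncomputable def palstarRules (α : Type*) [Fintype α] : Finset (ContextFreeRule α Bool) :=
  {⟨false, []⟩, ⟨false, [.nonterminal true, .nonterminal false]⟩} ∪
    (Finset.univ.image (fun a : α => ⟨true, [.terminal a, .nonterminal true, .terminal a]⟩) ∪
      Finset.univ.image (fun a : α => ⟨true, [.terminal a, .terminal a]⟩))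

lemma mem_palstarRules {α : Type*} [Fintype α] {r : ContextFreeRule α Bool} :
    r ∈ palstarRules α ↔ r = ⟨false, []⟩ ∨
      r = ⟨false, [.nonterminal true, .nonterminal false]⟩ ∨
      (∃ a : α, r = ⟨true, [.terminal a, .nonterminal true, .terminal a]⟩) ∨
      ∃ a : α, r = ⟨true, [.terminal a, .terminal a]⟩ := by
  simp only [palstarRules, Finset.mem_union, Finset.mem_insert, Finset.mem_singleton,
    Finset.mem_image, Finset.mem_univ, true_and, or_assoc, eq_comm (b := r)]

/-- A context-free grammar for the palstars. -/
noncomputable def palstarGrammar (α : Type*) [Fintype α] : ContextFreeGrammar α where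
  NT := Bool
  initial := false
  rules := palstarRules α

lemma palstarGrammar_sound {α : Type*} [Fintype α] (h : ℕ) :
    (∀ w, (palstarGrammar α).GenHeight h true w → w ∈ PAL α) ∧
      ∀ w, (palstarGrammar α).GenHeight h false w → w ∈ PALSTAR α := by
  induction h with
  | zero => exact ⟨fun _ h => h.elim, fun _ h => h.elim⟩
  | succ h ih =>
    constructor <;> rintro w ⟨r, hr, hA, hy⟩ <;>
      rcases mem_palstarRules.1 hr with rfl | rfl | ⟨a, rfl⟩ | ⟨a, rfl⟩
    · cases hA
    · cases hA
    · cases hy with | terminal _ hy =>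
      cases hy with | nonterminal hu hy =>
      cases hy with | terminal _ hy =>
      cases hy
      obtain ⟨x, -, rfl⟩ := ih.1 _ hu
      exact ⟨a :: x, by simp, by simp⟩
    · cases hy with | terminal _ hy =>
      cases hy with | terminal _ hy =>
      cases hy
      exact ⟨[a], by simp, by simp⟩
    · cases hy
      exact Language.nil_mem_kstar _
    · cases hy with | nonterminal hu hy =>
      cases hy with | nonterminal hv hy =>
      cases hy
      simpa using append_mem_PALSTAR (PAL_subset_PALSTAR (ih.1 _ hu)) (ih.2 _ hv)
    · cases hA
    · cases hA

lemma palstarGrammar_derives_PAL {α : Type*} [Fintype α] {x : List α} (hx : x ≠ []) :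
    (palstarGrammar α).Derives [.nonterminal true] ((x ++ x.reverse).map .terminal) := by
  induction x with
  | nil => exact absurd rfl hx
  | cons a x ih =>
    rcases eq_or_ne x [] with rfl | hx
    · exact ContextFreeGrammar.derives_of_mem_rules (g := palstarGrammar α)
        (mem_palstarRules.2 (.inr (.inr (.inr ⟨a, rfl⟩))))
    · refine (ContextFreeGrammar.derives_of_mem_rules (g := palstarGrammar α)
        (mem_palstarRules.2 (.inr (.inr (.inl ⟨a, rfl⟩))))).trans ?_
      have := ((ih hx).append_left [.terminal a]).append_right [.terminal a]
      simp only [List.map_append, List.map_cons, List.reverse_cons, List.map_nil, List.cons_append,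
        List.nil_append, List.append_assoc] at this ⊢
      exact this

lemma palstarGrammar_derives_PALSTAR {α : Type*} [Fintype α] {w : List α} (hw : w ∈ PALSTAR α) :
    (palstarGrammar α).Derives [.nonterminal false] (w.map .terminal) := by
  obtain ⟨l, rfl, hl⟩ := Language.mem_kstar.1 hw
  clear hw
  induction l with
  | nil =>
    exact ContextFreeGrammar.derives_of_mem_rules (g := palstarGrammar α)
      (mem_palstarRules.2 (.inl rfl))
  | cons u l ih =>
    obtain ⟨x, hx, rfl⟩ := hl u (by simp)
    refine (ContextFreeGrammar.derives_of_mem_rules (g := palstarGrammar α)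
      (mem_palstarRules.2 (.inr (.inl rfl)))).trans ?_
    rw [List.flatten_cons, List.map_append]
    exact ((palstarGrammar_derives_PAL hx).append_right [.nonterminal false]).trans
      ((ih fun y hy => hl y (by simp [hy])).append_left _)

theorem isContextFree_PALSTAR (α : Type*) [Finite α] : (PALSTAR α).IsContextFree := by
  have := Fintype.ofFinite α
  refine ⟨palstarGrammar α, Language.ext fun w => ?_⟩
  refine ⟨fun hw => ?_, palstarGrammar_derives_PALSTAR⟩
  obtain ⟨h, hh⟩ := ContextFreeGrammar.Derives.exists_genHeight hw
  exact (palstarGrammar_sound h).2 _ hh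

end Palstars

/-! ### Stutters and alternating words -/

namespace Palstars

variable {α : Type*}

open Classical in
/-- `1` if the two given letters exist and are equal, and `0` otherwise. -/
noncomputable def junction : Option α → Option α → ℕ
  | some a, some b => if a = b then 1 else 0
  | _, _ => 0

lemma junction_comm (o o' : Option α) : junction o o' = junction o' o := by
  rcases o with _ | a <;> rcases o' with _ | b <;> simp only [junction]
  split_ifs <;> simp_all

/-- The number of pairs of equal consecutive letters of a word. -/
noncomputable def stutters : List α → ℕ
  | [] => 0
  | a :: w => junction (some a) w.head? + stutters w

lemma stutters_append (u v : List α) :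
    stutters (u ++ v) = stutters u + stutters v + junction u.getLast? v.head? := by
  induction u with
  | nil => simp [stutters, junction]
  | cons a u ih =>
    rw [List.cons_append, stutters, stutters, ih]
    cases u with
    | nil => simp [stutters, junction]; omega
    | cons b u => simp; omega

lemma stutters_reverse (w : List α) : stutters w.reverse = stutters w := by
  induction w with
  | nil => rfl
  | cons a w ih =>
    have h : stutters [a] = 0 := by simp [stutters, junction]
    rw [List.reverse_cons, stutters_append, ih, List.getLast?_reverse, h, junction_comm,
      List.head?_singleton, stutters.eq_2]
    omega

lemma stutters_append_reverse {w : List α} (hw : w ≠ []) :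
    stutters (w ++ w.reverse) = 2 * stutters w + 1 := by
  rw [stutters_append, stutters_reverse, List.head?_reverse, List.getLast?_eq_some_getLast hw]
  simp [junction]
  omega

lemma stutters_eq_zero_iff {w : List α} : stutters w = 0 ↔ w.IsChain (· ≠ ·) := by
  induction w with
  | nil => simp [stutters]
  | cons a w ih =>
    cases w with
    | nil => simp [stutters, junction]
    | cons b w => rw [stutters, List.isChain_cons_cons, ← ih]; simp [junction]

lemma exists_of_stutters_eq_one {w : List α} (hw : stutters w = 1) :
    ∃ s a t, w = s ++ a :: a :: t ∧ (s ++ [a]).IsChain (· ≠ ·) ∧ (a :: t).IsChain (· ≠ ·) := by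
  induction w with
  | nil => simp [stutters] at hw
  | cons b w ih =>
    cases w with
    | nil => simp [stutters, junction] at hw
    | cons c w =>
      by_cases hbc : b = c
      · subst hbc
        refine ⟨[], b, w, rfl, by simp, stutters_eq_zero_iff.1 ?_⟩
        rw [stutters] at hw
        simpa [junction] using hw
      · rw [stutters] at hw
        simp only [junction, List.head?_cons, hbc, if_false, zero_add] at hw
        obtain ⟨s, a, t, h, hs, ht⟩ := ih hw
        refine ⟨b :: s, a, t, by rw [h]; rfl, ?_, ht⟩
        cases s with
        | nil =>
          simp only [List.nil_append, List.cons.injEq] at h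
          simpa [← h.1] using hbc
        | cons d s =>
          simp only [List.cons_append, List.cons.injEq] at h
          rw [← h.1] at hs ⊢
          simpa using ⟨hbc, by simpa using hs⟩

/-- The first stutter of a word is unique. -/
lemma stutter_unique {s t x : List α} {a b : α} (hs : (s ++ [a]).IsChain (· ≠ ·))
    (ht : (a :: t).IsChain (· ≠ ·)) (hx : x ++ [b, b] <+: s ++ a :: a :: t) : x = s ∧ b = a := by
  induction s generalizing x with
  | nil =>
    cases x with
    | nil => simpa using hx
    | cons c x =>
      have hx' : x ++ [b, b] <+: a :: t := by simpa using (List.cons_prefix_cons.1 hx).2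
      have := (ht.prefix hx').right_of_append
      simp at this
  | cons d s ih =>
    cases x with
    | nil =>
      cases s with
      | nil => simp at hx hs; exact absurd (hx.1.symm.trans hx.2) hs
      | cons e s =>
        simp at hx hs
        exact absurd (hx.1.symm.trans hx.2) hs.1
    | cons c x =>
      obtain ⟨rfl, h⟩ := List.cons_prefix_cons.1 hx
      obtain ⟨rfl, rfl⟩ := ih hs.tail h
      exact ⟨rfl, rfl⟩

/-- Two words without stutters over a two-letter alphabet that start with the same letter are
comparable. -/
lemma prefix_of_isChain {a b c : α} {u v : List α} (hu : (c :: u).IsChain (· ≠ ·))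
    (hv : (c :: v).IsChain (· ≠ ·)) (hua : ∀ x ∈ c :: u, x = a ∨ x = b)
    (hva : ∀ x ∈ c :: v, x = a ∨ x = b) (hlen : u.length ≤ v.length) : u <+: v := by
  induction u generalizing c v with
  | nil => simp
  | cons d u ih =>
    cases v with
    | nil => simp at hlen
    | cons e v =>
      have hc := hua c (by simp)
      have hd := hua d (by simp)
      have he := hva e (by simp)
      have hcd := (List.isChain_cons_cons.1 hu).1
      have hce := (List.isChain_cons_cons.1 hv).1
      obtain rfl : d = e := by grind
      refine List.cons_prefix_cons.2 ⟨rfl, ih hu.tail hv.tail (fun x hx => hua x ?_)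
        (fun x hx => hva x ?_) (by simpa using hlen)⟩ <;> exact List.mem_cons_of_mem _ hx

/-- The first letter, the last letter, and the number of stutters, counted up to `4`. -/
noncomputable def stutterType (w : List α) : Option α × Option α × Fin 5 :=
  (w.head?, w.getLast?, ⟨min (stutters w) 4, by omega⟩)

lemma stutterType_eq_iff {u v : List α} : stutterType u = stutterType v ↔
    u.head? = v.head? ∧ u.getLast? = v.getLast? ∧ min (stutters u) 4 = min (stutters v) 4 := by
  simp [stutterType]

/-- Only the end letters decide whether a junction adds a stutter, so replacing a factor by one of
the same type preserves the type of the whole word. -/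
lemma stutterType_append {u u' v v' : List α} (hu : stutterType u = stutterType u')
    (hv : stutterType v = stutterType v') : stutterType (u ++ v) = stutterType (u' ++ v') := by
  rw [stutterType_eq_iff] at *
  obtain ⟨h₁, h₂, h₃⟩ := hu
  obtain ⟨k₁, k₂, k₃⟩ := hv
  refine ⟨by simp [List.head?_append, h₁, k₁], by simp [List.getLast?_append, h₂, k₂], ?_⟩
  rw [stutters_append, stutters_append, h₂, k₁]
  omega

/-- The word of length `n` in which the letters `a` and `b` alternate. -/
def alternating (a b : α) : ℕ → List α
  | 0 => []
  | n + 1 => a :: alternating b a n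

lemma length_alternating (a b : α) (n : ℕ) : (alternating a b n).length = n := by
  induction n generalizing a b with
  | zero => rfl
  | succ n ih => simp [alternating, ih]

lemma mem_alternating {a b x : α} {n : ℕ} (hx : x ∈ alternating a b n) : x = a ∨ x = b := by
  induction n generalizing a b with
  | zero => simp [alternating] at hx
  | succ n ih =>
    rcases List.mem_cons.1 hx with rfl | hx
    · exact .inl rfl
    · exact (ih hx).symm

lemma isChain_alternating {a b : α} (hab : a ≠ b) (n : ℕ) :
    (alternating a b n).IsChain (· ≠ ·) := by
  induction n generalizing a b with
  | zero => simp [alternating]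
  | succ n ih =>
    cases n with
    | zero => simp [alternating]
    | succ n => exact List.isChain_cons_cons.2 ⟨hab, ih hab.symm⟩

end Palstars

/-! ### The extremal prime palstar and its pumping -/

namespace Palstars

variable {α : Type*}

lemma isChain_reverse_ne {w : List α} (hw : w.IsChain (· ≠ ·)) : w.reverse.IsChain (· ≠ ·) := by
  rw [← stutters_eq_zero_iff] at *
  rwa [stutters_reverse]

lemma append_reverse_mem_PALSTAR (w : List α) : w ++ w.reverse ∈ PALSTAR α := by
  rcases eq_or_ne w [] with rfl | hw
  · exact Language.nil_mem_kstar _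
  · exact PAL_subset_PALSTAR ⟨w, hw, rfl⟩

/-- The half of an even palindrome which is prime although it only just avoids the palindromic
prefix `d r f f rᴿ d`. -/
def halfWord (d f : α) (r : List α) : List α := d :: r ++ f :: f :: r.reverse

lemma halfWord_append_reverse_mem_PRIMEPALSTAR {d f : α} {r : List α}
    (hr : (d :: r ++ [f]).IsChain (· ≠ ·)) :
    halfWord d f r ++ (halfWord d f r).reverse ∈ PRIMEPALSTAR α := by
  refine ⟨append_reverse_mem_PALSTAR _, by simp [halfWord], ?_⟩
  rintro ⟨u, v, hu, hu0, -, hv0, h⟩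
  obtain ⟨_, v', ⟨x, hx0, rfl⟩, -, rfl⟩ := exists_PAL_prefix hu hu0
  have hv := List.length_pos_iff.2 hv0
  obtain rfl | ⟨x, e, rfl⟩ := List.eq_nil_or_concat x
  · exact hx0 rfl
  have hlen := congrArg List.length h
  simp only [List.length_append, List.length_reverse, List.concat_eq_append] at hlen
  -- The palindrome is a proper prefix, so its central stutter `e e` ends within the first half.
  have hpre : x ++ [e, e] <+: halfWord d f r := by
    refine List.prefix_of_prefix_length_le (l₃ := halfWord d f r ++ (halfWord d f r).reverse)
      ?_ (List.prefix_append _ _) (by simp at hlen ⊢; omega)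
    rw [h]
    exact ⟨x.reverse ++ v' ++ v, by simp⟩
  have hr' : (f :: r.reverse).IsChain (· ≠ ·) := by
    have := isChain_reverse_ne hr.tail
    simpa using this
  obtain ⟨rfl, rfl⟩ := stutter_unique (s := d :: r) hr hr' hpre
  -- The palindrome would have to end in `d`, where the word has the first letter of `r f`.
  have h' : (halfWord d e r).reverse = d :: (v' ++ v) := by
    simpa [halfWord] using h
  cases r with
  | nil =>
    simp [halfWord] at h' hr
    exact hr h'.1.symm
  | cons c r =>
    simp [halfWord] at h' hr
    exact hr.1 h'.1.symm

/-- A prime palstar over two letters with exactly three stutters is at most four times as long as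
its first run. -/
lemma length_le_of_mem_PRIMEPALSTAR {a b f : α} {s z : List α} (hz : z ∈ PRIMEPALSTAR α)
    (hst : stutters z = 3) (hab : ∀ x ∈ z, x = a ∨ x = b) (hs : (s ++ [f]).IsChain (· ≠ ·))
    (hsz : s ++ [f, f] <+: z) : z.length ≤ 4 * s.length + 2 := by
  obtain ⟨w, hw, rfl⟩ := mem_PAL_of_mem_PRIMEPALSTAR hz
  rw [stutters_append_reverse hw] at hst
  obtain ⟨s', e, t, rfl, hs', ht⟩ := exists_of_stutters_eq_one (w := w) (by omega)
  have hs'z : s' ++ [e, e] <+: s' ++ e :: e :: t ++ (s' ++ e :: e :: t).reverse :=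
    ⟨t ++ (s' ++ e :: e :: t).reverse, by simp⟩
  obtain ⟨rfl, rfl⟩ : s = s' ∧ f = e := by
    -- The longer prefix is cut right after its stutter, hence `t := []`.
    rcases List.prefix_or_prefix_of_prefix hsz hs'z with h | h
    · exact stutter_unique (t := []) hs' (by simp) h
    · obtain ⟨h₁, h₂⟩ := stutter_unique (t := []) hs (by simp) h
      exact ⟨h₁.symm, h₂.symm⟩
  by_contra hlen
  -- The negated bound says `|s| ≤ |t|`, and `f sᴿ` and `f t` both alternate from `f`.
  have hts : s.reverse <+: t := by
    refine prefix_of_isChain (c := f) (a := a) (b := b) ?_ ht (fun x hx => hab x ?_)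
      (fun x hx => hab x ?_) (by simp at hlen ⊢; omega)
    · simpa using isChain_reverse_ne hs
    · simp at hx ⊢; tauto
    · simp at hx ⊢; tauto
  obtain ⟨m, rfl⟩ := hts
  refine hz.2.2 ⟨(s ++ [f]) ++ (s ++ [f]).reverse,
    (m ++ m.reverse) ++ ((s ++ [f]) ++ (s ++ [f]).reverse), append_reverse_mem_PALSTAR _, by simp,
    append_mem_PALSTAR (append_reverse_mem_PALSTAR _) (append_reverse_mem_PALSTAR _), by simp,
    by simp⟩

lemma reverse_eq_of_mem_PRIMEPALSTAR {z : List α} (hz : z ∈ PRIMEPALSTAR α) : z.reverse = z := by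
  obtain ⟨x, -, rfl⟩ := mem_PAL_of_mem_PRIMEPALSTAR hz
  simp

theorem not_isContextFree_PRIMEPALSTAR (α : Type*) [Finite α] [Nontrivial α] :
    ¬ (PRIMEPALSTAR α).IsContextFree := by
  intro hcf
  obtain ⟨a, b, hab⟩ := exists_pair_ne α
  obtain ⟨p, hp⟩ := hcf.exists_pumping (stutterType (α := α))
  obtain ⟨r, f, hrf⟩ : ∃ r f, alternating b a (p + 1) = r ++ [f] := by
    rcases List.eq_nil_or_concat (alternating b a (p + 1)) with h | ⟨r, f, h⟩
    · simp [alternating] at h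
    · exact ⟨r, f, by simpa using h⟩
  have hr : r.length = p := by simpa [length_alternating] using (congrArg List.length hrf).symm
  have hchain : (a :: r ++ [f]).IsChain (· ≠ ·) := by
    have := isChain_alternating hab (p + 2)
    rw [alternating, hrf] at this
    exact this
  have hletters : ∀ x ∈ halfWord a f r ++ (halfWord a f r).reverse, x = a ∨ x = b := by
    have key : ∀ x ∈ r ++ [f], x = a ∨ x = b := fun x hx =>
      (mem_alternating (hrf ▸ hx)).symm
    intro x hx
    by_cases hxa : x = a
    · exact .inl hxa
    · refine key x ?_
      simp [halfWord] at hx ⊢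
      tauto
  have hst : stutters (halfWord a f r ++ (halfWord a f r).reverse) = 3 := by
    have h₁ : stutters (a :: r ++ [f]) = 0 := stutters_eq_zero_iff.2 hchain
    have h₂ : stutters (f :: r.reverse) = 0 := by
      rw [stutters_eq_zero_iff]
      simpa using isChain_reverse_ne hchain.tail
    have h₃ : halfWord a f r = (a :: r ++ [f]) ++ (f :: r.reverse) := by simp [halfWord]
    have h₄ : (a :: r ++ [f]).getLast? = some f := by
      rw [List.getLast?_append]; rfl
    rw [stutters_append_reverse (by simp [halfWord]), h₃, stutters_append, h₁, h₂, h₄]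
    simp [junction]
  have hlen : (halfWord a f r ++ (halfWord a f r).reverse).length = 4 * p + 6 := by
    simp [halfWord, hr]; omega
  have hpre : a :: r ++ [f, f] <+: halfWord a f r ++ (halfWord a f r).reverse :=
    ⟨r.reverse ++ (halfWord a f r).reverse, by simp [halfWord]⟩
  have hmem := halfWord_append_reverse_mem_PRIMEPALSTAR hchain
  generalize halfWord a f r ++ (halfWord a f r).reverse = z at *
  obtain ⟨u, v, w, x, y, rfl, hvwx, hvx, hc, hmem'⟩ := hp z hmem (by omega)
  have htype : stutterType (u ++ (v ++ (v ++ w ++ x) ++ x) ++ y) =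
      stutterType (u ++ (v ++ w ++ x) ++ y) :=
    stutterType_append (stutterType_append rfl
      (stutterType_append (stutterType_append rfl hc) rfl)) rfl
  -- The cap at `4` still separates three stutters from more.
  have hst' : stutters (u ++ (v ++ (v ++ w ++ x) ++ x) ++ y) = 3 := by
    have := (stutterType_eq_iff.1 htype).2.2
    omega
  have hpre' : a :: r ++ [f, f] <+: u ++ (v ++ (v ++ w ++ x) ++ x) ++ y := by
    have hPlen : (a :: r ++ [f, f]).length = p + 3 := by simp [hr]
    -- The factor `v w x` has at most `p` of the `4 * p + 6` letters, so it misses the first or the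
    -- last `p + 3`. In the latter case the prefix survives as the reversal of the suffix.
    rcases Nat.lt_or_ge u.length (p + 3) with hu | hu
    · have hy : p + 3 ≤ y.length := by
        simp only [List.length_append] at hlen hvwx
        omega
      rw [← reverse_eq_of_mem_PRIMEPALSTAR hmem] at hpre
      rw [← reverse_eq_of_mem_PRIMEPALSTAR hmem']
      rw [List.reverse_append] at hpre ⊢
      exact (List.prefix_of_prefix_length_le hpre (List.prefix_append _ _)
        (by rw [List.length_reverse]; omega)).trans (List.prefix_append _ _)
    · rw [List.append_assoc] at hpre ⊢
      exact (List.prefix_of_prefix_length_le hpre (List.prefix_append _ _) (by omega)).trans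
        (List.prefix_append _ _)
  have hletters' : ∀ l ∈ u ++ (v ++ (v ++ w ++ x) ++ x) ++ y, l = a ∨ l = b := fun l hl =>
    hletters l (by simp at hl ⊢; tauto)
  -- The bound `4 * (p + 1) + 2` is already the length before pumping.
  have := length_le_of_mem_PRIMEPALSTAR hmem' hst' hletters' hchain (by simpa using hpre')
  simp only [List.length_append, List.length_cons, hr] at this hlen
  omega

end Palstars

theorem theorem7 (α : Type*) [Finite α] [Nontrivial α] :
    ¬ (Palstars.PRIMEPALSTAR α).IsContextFree ∧
    Palstars.IsStarClosed (Palstars.PALSTAR α) ∧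
    (Palstars.PALSTAR α).IsContextFree ∧
    Palstars.PRIMEPALSTAR α = Palstars.inverseStar (Palstars.PALSTAR α) ∧
    ¬ (∀ L : Language α, Palstars.IsStarClosed L → L.IsContextFree →
        (Palstars.inverseStar L).IsContextFree) := by
  refine ⟨Palstars.not_isContextFree_PRIMEPALSTAR α, Palstars.isStarClosed_PALSTAR α,
    Palstars.isContextFree_PALSTAR α, Palstars.PRIMEPALSTAR_eq_inverseStar α, fun h => ?_⟩
  have := h _ (Palstars.isStarClosed_PALSTAR α) (Palstars.isContextFree_PALSTAR α)
  rw [← Palstars.PRIMEPALSTAR_eq_inverseStar] at this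
  exact Palstars.not_isContextFree_PRIMEPALSTAR α this
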